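/- Let $m\ge 2$ and let $t_1,\dots,t_m$ be nonnegative integers with $t_1\ge 1$, $t_m\ge 1$ and $t_it_{i+1}\cdots t_m0^\omega\prec_{\rm lex}t_1t_2\cdots t_m0^\omega$ for all $i\in\{2,\dots,m\}$. Let $\varphi$ be the morphism over $\{0,1,\dots,m-1\}$ given by $\varphi(k)=0^{t_{k+1}}(k+1)$ for $0\le k\le m-2$ and $\varphi(m-1)=0^{t_m}$, and let $\mathbf u$ be a fixed point of $\varphi$ (the simple Parry sequence with parameters $t_1,\dots,t_m$). Put $u_n=\varphi^n(0)$, $U_n=|u_n|$ for $n\ge 0$, and $u_n=\varepsilon$ for $n<0$. For $n\ge m$ let $$z_n=u_n\,u_{n-m}^{t_1-t_m}\,u_{n-m-1}^{t_2}\cdots u_{n-2m+1}^{t_m},\qquad Z_n=|z_n|.$$ Let $\Gamma_n=\{U_0-1,\dots,U_n-1\}$ for $0\le n\le m-1$ and $\Gamma_n=\{U_{n-m+1}-1,\dots,U_n-1\}$ for $n\ge m$. An attractor of a finite word $w=w_0\cdots w_{N-1}$ is a set $\Gamma\subseteq\{0,\dots,N-1\}$ such that every nonempty factor of $w$ has an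 occurrence $w_s\cdots w_{e}$ in $w$ with $\{s,\dots,e\}\cap\Gamma\ne\emptyset$; it is minimal if no attractor of $w$ has fewer elements. Theorem. Assume that (1) $t_i\cdots t_{m-2}(t_{m-1}+1)0^\omega\prec_{\rm lex}t_1t_2\cdots t_m0^\omega$ for all $i\in\{2,\dots,m-2\}$, and (2) $t_1>\max\{t_{m-1},t_m\}$. Then every prefix of $\mathbf u$ has a minimal attractor that is a subset of $\{U_n-1 : n\in\mathbb N\}$. More precisely: - for each $0\le n\le m-1$, the prefix of $\mathbf u$ of length $\ell\in[U_n,U_{n+1}-1]$ has the minimal attractor $\Gamma_n$; - for each $n\ge m$, the prefix of $\mathbf u$ of length $\ell\in[U_n,Z_n]$ has the minimal attractor $\Gamma_{n-1}$; - for each $n\ge m$, the prefix of $\mathbf u$ of length $\ell\in[Z_n,U_{n+1}]$ has the minimal attractor $\Gamma_n$. -/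

import Mathlib

namespace SimpleParry

/-! ### Words, sequences, attractors -/

/-- The prefix `u_0 u_1 ⋯ u_{ℓ-1}` of length `ℓ` of the sequence `u`. -/
def pref {α : Type*} (u : ℕ → α) (ℓ : ℕ) : List α :=
  (List.range ℓ).map u

/-- The `k`-th power `w ^ k = w w ⋯ w` of the word `w`. -/
def wordPow {α : Type*} (w : List α) (k : ℕ) : List α :=
  (List.replicate k w).flatten

/-- The set of positions `{s, s + 1, …, s + |f| - 1}` is an occurrence of `f` in `w`. -/
def OccursAt {α : Type*} (f w : List α) (s : ℕ) : Prop :=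
  f <+: w.drop s

/-- `Γ` is a string attractor of the finite word `w`: a set of positions of `w` such that every
nonempty factor of `w` has an occurrence in `w` containing an element of `Γ`. -/
def IsAttractor {α : Type*} (w : List α) (Γ : Finset ℕ) : Prop :=
  (∀ g ∈ Γ, g < w.length) ∧
  ∀ f : List α, f ≠ [] → f <:+: w →
    ∃ s : ℕ, OccursAt f w s ∧ ∃ g ∈ Γ, s ≤ g ∧ g < s + f.length

/-- An attractor of `w` with the minimal number of elements. -/
def IsMinimalAttractor {α : Type*} (w : List α) (Γ : Finset ℕ) : Prop :=
  IsAttractor w Γ ∧ ∀ Δ : Finset ℕ, IsAttractor w Δ → Γ.card ≤ Δ.card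

/-- The image of a finite word under the morphism given by its values on letters. -/
def applyMorphism {α : Type*} (φ : α → List α) (w : List α) : List α :=
  w.flatMap φ

/-- The sequence `u` is a fixed point of the morphism `φ`: the infinite concatenation
`φ(u_0) φ(u_1) φ(u_2) ⋯` is infinite and equal to `u`. -/
def IsFixedPoint {α : Type*} (φ : α → List α) (u : ℕ → α) : Prop :=
  (∀ n : ℕ, applyMorphism φ (pref u n) = pref u (applyMorphism φ (pref u n)).length) ∧
  ∀ N : ℕ, ∃ n : ℕ, N ≤ (applyMorphism φ (pref u n)).length

/-- The sequence `w 0^ω` of nonnegative integers. -/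
def padZero (w : List ℕ) : ℕ → ℕ :=
  fun j => w.getD j 0

/-- `LexLT v w` says that `v 0^ω` is lexicographically smaller than `w 0^ω`. -/
def LexLT (v w : List ℕ) : Prop :=
  toLex (padZero v) < toLex (padZero w)

/-- The word `t_i t_{i+1} ⋯ t_j` of parameters (empty if `j < i`). -/
def params (t : ℕ → ℕ) (i j : ℕ) : List ℕ :=
  (List.Ico i (j + 1)).map t

/-! ### Simple Parry sequences

The parameters are `t 1, …, t m`; the other values of `t` play no role. -/

/-- The morphism `φ(k) = 0^{t_{k+1}} (k+1)` for `k ≤ m - 2` and `φ(m-1) = 0^{t_m}`, over the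
alphabet `{0, 1, …, m - 1}`. -/
def parryMorphism (m : ℕ) [NeZero m] (t : ℕ → ℕ) (k : Fin m) : List (Fin m) :=
  List.replicate (t (k.val + 1)) 0 ++
    if h : k.val + 1 < m then [⟨k.val + 1, h⟩] else []

/-- `u` is the simple Parry sequence with parameters `t_1, …, t_m`. -/
structure IsSimpleParry (m : ℕ) [NeZero m] (t : ℕ → ℕ) (u : ℕ → Fin m) : Prop where
  two_le : 2 ≤ m
  first_pos : 1 ≤ t 1
  last_pos : 1 ≤ t m
  lex : ∀ i, 2 ≤ i → i ≤ m → LexLT (params t i m) (params t 1 m)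
  fixed : IsFixedPoint (parryMorphism m t) u

/-- The word `u_n = φ^n(0)`. -/
def word (m : ℕ) [NeZero m] (t : ℕ → ℕ) (n : ℕ) : List (Fin m) :=
  (applyMorphism (parryMorphism m t))^[n] [0]

/-- The words `u_n` for `n ∈ ℤ`, with `u_n = ε` for `n < 0`. -/
def wordInt (m : ℕ) [NeZero m] (t : ℕ → ℕ) (n : ℤ) : List (Fin m) :=
  if 0 ≤ n then word m t n.toNat else []

/-- `U_n = |u_n|`. -/
def lenU (m : ℕ) [NeZero m] (t : ℕ → ℕ) (n : ℕ) : ℕ :=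
  (word m t n).length

/-- `z_n = u_n u_{n-m}^{t_1 - t_m} u_{n-m-1}^{t_2} ⋯ u_{n-2m+1}^{t_m}` (used for `n ≥ m`; note that
`t_m ≤ t_1` for simple Parry sequences). -/
def wordZ (m : ℕ) [NeZero m] (t : ℕ → ℕ) (n : ℕ) : List (Fin m) :=
  word m t n ++ wordPow (wordInt m t ((n : ℤ) - m)) (t 1 - t m) ++
    (List.Ico 2 (m + 1)).flatMap fun j : ℕ => wordPow (wordInt m t ((n : ℤ) - m + 1 - j)) (t j)

/-- `Z_n = |z_n|`. -/
def lenZ (m : ℕ) [NeZero m] (t : ℕ → ℕ) (n : ℕ) : ℕ :=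
  (wordZ m t n).length

/-- `Γ_n = {U_0 - 1, …, U_n - 1}` for `n ≤ m - 1`, and
`Γ_n = {U_{n-m+1} - 1, …, U_n - 1}` for `n ≥ m`. -/
def Gam (m : ℕ) [NeZero m] (t : ℕ → ℕ) (n : ℕ) : Finset ℕ :=
  if n ≤ m - 1 then (Finset.Icc 0 n).image fun i => lenU m t i - 1
  else (Finset.Icc (n - m + 1) n).image fun i => lenU m t i - 1

end SimpleParry

/-!
A factor of a word with period `p` either lies in the prefix of length `p` or has an occurrence
containing the position `p - 1`. Hence a set `Γ ∋ p - 1` that meets all factors of the prefix of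
length `p` is an attractor of the whole word (`Covers.of_period`), and the proof consists in finding
periods of prefixes of `u`.

The words `u_n` satisfy `u_n = u_{n-1}^{t_1} u_{n-2}^{t_2} ⋯ u_{n-m}^{t_m}`, followed by the letter
`n` if `n < m` (`word_eq`). Products of this kind are compared greedily: if `a 0^ω ≺ b 0^ω` and the
nonempty proper suffixes of `a` are smaller than `t_1 ⋯ t_m`, the product with exponents `a` is a
prefix of the one with exponents `b` (`prodWord_prefix`). With the Parry condition this shows that `u_{n+1}`,
without its new last letter if there is one, has period `U_n` (`period_prodWord`); this settles the
prefixes shorter than `U_m`. For `n ≥ m`,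
`z_n = u_{n-1}^{t_1} ⋯ u_{n-m+1}^{t_{m-1}} v`, where `v = u_{n-m}^{t_1} u_{n-m-1}^{t_2} ⋯` is a
prefix of `u_{n-m+1}`, so `z_n` is a prefix of the product with exponents
`t_1, …, t_{m-2}, t_{m-1} + 1`. The assumptions on these exponents give `z_n` the period `U_{n-1}`
(`period_wordZ`), and therefore `Γ_{n-1}` remains an attractor up to the length `Z_n`.

From `Z_n` on, `Γ_n` takes over. By the period `U_n` only factors of `u_n` matter, and among these
only the ones met by `U_{n-m} - 1`, the position lost from `Γ_{n-1}`, and by no other position. They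
are factors of `v`, and `z_n` ends with a copy of `v` that starts `t_m U_{n-m}` letters before the
end of `u_n`. Since `t_m < t_1`, the period `U_{n-m}` of `v` leaves room to move the factor across
`U_n - 1` inside this copy (`covers_gam_step`).

The attractors are minimal because they have as many elements as the prefix has letters.
-/

namespace SimpleParry

/-! ### Prefixes of a sequence -/

theorem wordPow_zero {α : Type*} (w : List α) : wordPow w 0 = [] := rfl

theorem wordPow_succ {α : Type*} (w : List α) (k : ℕ) :
    wordPow w (k + 1) = w ++ wordPow w k := by
  simp [wordPow, List.replicate_succ]

theorem wordPow_add {α : Type*} (w : List α) (k l : ℕ) :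
    wordPow w (k + l) = wordPow w k ++ wordPow w l := by
  rw [wordPow, List.replicate_add, List.flatten_append]
  rfl

theorem wordPow_prefix {α : Type*} (w : List α) {k l : ℕ} (h : k ≤ l) :
    wordPow w k <+: wordPow w l := by
  obtain ⟨d, rfl⟩ := Nat.exists_eq_add_of_le h
  exact wordPow_add w k d ▸ List.prefix_append _ _

theorem length_wordPow {α : Type*} (w : List α) (k : ℕ) :
    (wordPow w k).length = k * w.length := by
  simp [wordPow]

/-- The finite word `w` is a prefix of the sequence `u`. -/
def IsPref {α : Type*} (u : ℕ → α) (w : List α) : Prop :=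
  ∀ i (h : i < w.length), w[i] = u i

theorem length_pref {α : Type*} (u : ℕ → α) (n : ℕ) : (pref u n).length = n := by
  simp [pref]

theorem isPref_pref {α : Type*} (u : ℕ → α) (n : ℕ) : IsPref u (pref u n) := by
  intro i h
  simp [pref]

theorem IsPref.of_prefix {α : Type*} {u : ℕ → α} {w v : List α} (hv : IsPref u v)
    (h : w <+: v) : IsPref u w := by
  intro i hi
  rw [h.getElem hi]
  exact hv i _

theorem IsPref.eq_pref {α : Type*} {u : ℕ → α} {w : List α} (h : IsPref u w) :
    w = pref u w.length := by
  apply List.ext_getElem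
  · simp [pref]
  · intro i h1 h2
    simp [pref, h i h1]

/-- If a prefix of `u` is a prefix of `x y`, where `y` is also a prefix of `u`, then `|x|` is a
period of it. -/
theorem IsPref.period {α : Type*} {u : ℕ → α} {w x y : List α} (hw : IsPref u w)
    (h : w <+: x ++ y) (hy : IsPref u y) (i : ℕ) (hi : x.length + i < w.length) :
    u (x.length + i) = u i := by
  have hl := h.length_le
  rw [List.length_append] at hl
  rw [← hw _ hi, h.getElem hi, List.getElem_append_right (by omega)]
  simp only [Nat.add_sub_cancel_left]
  exact hy i (by omega)

/-! ### Attractors of prefixes of a sequence -/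

/-- Every nonempty factor of the prefix of `u` of length `p` has an occurrence inside the prefix of
length `ℓ` that contains an element of `Γ`. -/
def Covers {α : Type*} (u : ℕ → α) (Γ : Finset ℕ) (p ℓ : ℕ) : Prop :=
  ∀ s len : ℕ, 0 < len → s + len ≤ p →
    ∃ s', s' + len ≤ ℓ ∧ (∀ k < len, u (s' + k) = u (s + k)) ∧ ∃ g ∈ Γ, s' ≤ g ∧ g < s' + len

theorem Covers.mono {α : Type*} {u : ℕ → α} {Γ : Finset ℕ} {p p' ℓ ℓ' : ℕ}
    (h : Covers u Γ p ℓ) (hp : p' ≤ p) (hl : ℓ ≤ ℓ') : Covers u Γ p' ℓ' := by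
  intro s len h0 hs
  obtain ⟨s', h1, h2⟩ := h s len h0 (by omega)
  exact ⟨s', by omega, h2⟩

theorem Covers.mono_set {α : Type*} {u : ℕ → α} {Γ Γ' : Finset ℕ} {p ℓ : ℕ}
    (h : Covers u Γ p ℓ) (hΓ : Γ ⊆ Γ') : Covers u Γ' p ℓ := by
  intro s len h0 hs
  obtain ⟨s', h1, h2, g, hg, h3⟩ := h s len h0 hs
  exact ⟨s', h1, h2, g, hΓ hg, h3⟩

theorem Covers.succ {α : Type*} {u : ℕ → α} {Γ : Finset ℕ} {p : ℕ}
    (h : Covers u Γ p p) (hp : p ∈ Γ) : Covers u Γ (p + 1) (p + 1) := by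
  intro s len h0 hs
  by_cases hc : s + len ≤ p
  · exact h.mono le_rfl (Nat.le_succ p) s len h0 hc
  · exact ⟨s, hs, fun _ _ => rfl, p, hp, by omega, by omega⟩

theorem apply_mul_add_of_period {α : Type*} {u : ℕ → α} {p L : ℕ}
    (hper : ∀ i, p + i < L → u (p + i) = u i) (j i : ℕ) (h : p * j + i < L) :
    u (p * j + i) = u i := by
  induction j with
  | zero => simp
  | succ j ih =>
    rw [Nat.mul_succ] at h ⊢
    rw [← ih (by omega), show p * j + p + i = p + (p * j + i) by ring]
    exact hper _ (by omega)

/-- In a prefix with period `p`, a factor is either a factor of the prefix of length `p`, or it has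
an occurrence containing the position `p - 1`. -/
theorem Covers.of_period {α : Type*} {u : ℕ → α} {Γ : Finset ℕ} {p ℓ : ℕ}
    (h : Covers u Γ p ℓ) (hp : 0 < p) (hΓ : p - 1 ∈ Γ)
    (hper : ∀ i, p + i < ℓ → u (p + i) = u i) : Covers u Γ ℓ ℓ := by
  intro s len h0 hs
  have hlt := Nat.mod_lt s hp
  have hdiv := Nat.div_add_mod s p
  have key : ∀ k < len, u (s % p + k) = u (s + k) := by
    intro k hk
    have := apply_mul_add_of_period hper (s / p) (s % p + k) (by omega)
    rw [← this]
    congr 1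
    omega
  have hle := Nat.mod_le s p
  by_cases hc : s % p + len ≤ p
  · obtain ⟨s', h1, h2, h3⟩ := h _ len h0 hc
    exact ⟨s', h1, fun k hk => (h2 k hk).trans (key k hk), h3⟩
  · exact ⟨s % p, by omega, key, p - 1, hΓ, by omega, by omega⟩

theorem Covers.isAttractor {α : Type*} {u : ℕ → α} {Γ : Finset ℕ} {ℓ : ℕ}
    (h : Covers u Γ ℓ ℓ) (hΓ : ∀ g ∈ Γ, g < ℓ) : IsAttractor (pref u ℓ) Γ := by
  refine ⟨by simpa [length_pref] using hΓ, ?_⟩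
  rintro f hf ⟨x, y, hxy⟩
  have hlen : x.length + f.length + y.length = ℓ := by
    simpa [length_pref, add_assoc] using congrArg List.length hxy
  have hu : ∀ k (hk : k < f.length), f[k] = u (x.length + k) := by
    intro k hk
    have h1 := isPref_pref u ℓ (x.length + k) (by rw [length_pref]; omega)
    rw [← h1]
    simp only [← hxy]
    rw [List.getElem_append_left (by simp; omega), List.getElem_append_right (by omega)]
    simp
  obtain ⟨s', h1, h2, h3⟩ := h x.length f.length (List.length_pos_iff.2 hf) (by omega)
  refine ⟨s', ?_, h3⟩
  rw [OccursAt, List.prefix_iff_eq_take]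
  apply List.ext_getElem
  · simp [length_pref]
    omega
  · intro i hi _
    rw [hu i hi, ← h2 i hi]
    simp [pref]

/-- An attractor has at least as many elements as the word has letters. -/
theorem IsAttractor.card_le {α : Type*} [DecidableEq α] {u : ℕ → α} {ℓ : ℕ} {Δ : Finset ℕ}
    (h : IsAttractor (pref u ℓ) Δ) {S : Finset α} (hS : ∀ a ∈ S, ∃ i < ℓ, u i = a) :
    S.card ≤ Δ.card := by
  refine le_trans (Finset.card_le_card ?_) (Finset.card_image_le (f := u))
  intro a ha
  obtain ⟨i, hi, rfl⟩ := hS a ha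
  have hmem : u i ∈ pref u ℓ := List.mem_map.2 ⟨i, by simpa using hi, rfl⟩
  obtain ⟨x, y, hxy⟩ := List.append_of_mem hmem
  obtain ⟨s, hs, g, hg, h1, h2⟩ := h.2 [u i] (by simp) ⟨x, y, by simp [hxy]⟩
  simp only [List.length_singleton] at h2
  obtain rfl : g = s := by omega
  refine Finset.mem_image.2 ⟨g, hg, ?_⟩
  have hgl : g < (pref u ℓ).length := h.1 g hg
  rw [OccursAt, List.drop_eq_getElem_cons hgl] at hs
  rw [← isPref_pref u ℓ g hgl]
  exact (List.cons_prefix_cons.1 hs).1.symm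

/-! ### Lexicographic order -/

theorem not_lexLT_nil (v : List ℕ) : ¬ LexLT v [] := by
  rintro ⟨i, -, h⟩
  simp [padZero] at h

theorem lexLT_cons_cons {a b : ℕ} {v w : List ℕ} :
    LexLT (a :: v) (b :: w) ↔ a < b ∨ a = b ∧ LexLT v w := by
  constructor
  · rintro ⟨i, h1, h2⟩
    cases i with
    | zero => exact Or.inl (by simpa [padZero] using h2)
    | succ i =>
      refine Or.inr ⟨by simpa [padZero] using h1 0 (Nat.succ_pos i), i, ?_, ?_⟩
      · intro j hj
        simpa [padZero] using h1 (j + 1) (by omega)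
      · simpa [padZero] using h2
  · rintro (h | ⟨rfl, i, h1, h2⟩)
    · exact ⟨0, fun j hj => absurd hj (Nat.not_lt_zero j), by simpa [padZero] using h⟩
    · refine ⟨i + 1, ?_, by simpa [padZero] using h2⟩
      rintro (_ | j) hj
      · rfl
      · simpa [padZero] using h1 j (by simpa using hj)

theorem nil_lexLT {w : List ℕ} (h : ∃ a ∈ w, 0 < a) : LexLT [] w := by
  induction w with
  | nil => simp at h
  | cons b w ih =>
    rcases Nat.eq_zero_or_pos b with rfl | hb
    · obtain ⟨i, h1, h2⟩ := ih (by simpa using h)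
      refine ⟨i + 1, ?_, by simpa [padZero] using h2⟩
      rintro (_ | j) hj
      · rfl
      · simpa [padZero] using h1 j (by simpa using hj)
    · exact ⟨0, fun j hj => absurd hj (Nat.not_lt_zero j), by simpa [padZero] using hb⟩

theorem length_params (t : ℕ → ℕ) (i j : ℕ) : (params t i j).length = j + 1 - i := by
  simp [params]

theorem params_cons (t : ℕ → ℕ) {i j : ℕ} (h : i ≤ j) :
    params t i j = t i :: params t (i + 1) j := by
  simp [params, List.Ico.eq_cons (show i < j + 1 by omega)]

theorem params_eq_nil (t : ℕ → ℕ) {i j : ℕ} (h : j < i) : params t i j = [] := by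
  simp [params, List.Ico.eq_nil_of_le (show j + 1 ≤ i by omega)]

theorem params_concat (t : ℕ → ℕ) {i j : ℕ} (h : i ≤ j) (hj : 1 ≤ j) :
    params t i j = params t i (j - 1) ++ [t j] := by
  simp [params, List.Ico.succ_top h, Nat.sub_add_cancel hj]

/-! ### Products of the words `u_n` -/

variable {m : ℕ} [NeZero m] {t : ℕ → ℕ} {u : ℕ → Fin m}

/-- The word `u_{n-1}^{a_1} u_{n-2}^{a_2} ⋯` with exponents `a_1, a_2, …`, where `u_k` is empty for
`k < 0`. -/
def prodWord (m : ℕ) [NeZero m] (t : ℕ → ℕ) : ℕ → List ℕ → List (Fin m)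
  | _, [] => []
  | 0, _ :: _ => []
  | n + 1, a :: l => wordPow (word m t n) a ++ prodWord m t n l

theorem prodWord_nil (n : ℕ) : prodWord m t n [] = [] := by
  cases n <;> rfl

theorem prodWord_zero (l : List ℕ) : prodWord m t 0 l = [] := by
  cases l <;> rfl

theorem prodWord_succ_cons (n a : ℕ) (l : List ℕ) :
    prodWord m t (n + 1) (a :: l) = wordPow (word m t n) a ++ prodWord m t n l := rfl

theorem prodWord_append (n : ℕ) (l l' : List ℕ) :
    prodWord m t n (l ++ l') = prodWord m t n l ++ prodWord m t (n - l.length) l' := by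
  induction l generalizing n with
  | nil => simp [prodWord_nil]
  | cons a l ih =>
    cases n with
    | zero => simp [prodWord_zero]
    | succ n =>
      simp [prodWord_succ_cons, ih, List.append_assoc]

/-- The product with exponents `t_i, …, t_r` in the form used to define `z_n`. -/
theorem prodWord_params (N i r : ℕ) :
    prodWord m t N (params t i r) =
      (List.Ico i (r + 1)).flatMap fun j : ℕ =>
        wordPow (wordInt m t ((N : ℤ) + i - 1 - j)) (t j) := by
  induction hd : r + 1 - i generalizing N i with
  | zero =>
    rw [params_eq_nil t (by omega), List.Ico.eq_nil_of_le (by omega)]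
    simp [prodWord_nil]
  | succ d ih =>
    rw [params_cons t (by omega), List.Ico.eq_cons (by omega), List.flatMap_cons]
    cases N with
    | zero =>
      rw [prodWord_zero]
      symm
      rw [List.append_eq_nil_iff, List.flatMap_eq_nil_iff]
      have key : ∀ j : ℕ, i ≤ j → wordPow (wordInt m t (((0 : ℕ) : ℤ) + i - 1 - j)) (t j) = [] := by
        intro j hj
        rw [wordInt, if_neg (by omega)]
        simp [wordPow]
      exact ⟨key i le_rfl, fun j hj => key j (by have := (List.Ico.mem.1 hj).1; omega)⟩
    | succ N =>
      rw [prodWord_succ_cons, ih N (i + 1) (by omega)]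
      congr 1
      · rw [wordInt, if_pos (by push_cast; omega)]
        congr 2
        push_cast
        omega
      · congr 1
        funext j
        congr 2
        push_cast
        ring

theorem iterate_append (n : ℕ) (v w : List (Fin m)) :
    (applyMorphism (parryMorphism m t))^[n] (v ++ w) =
      (applyMorphism (parryMorphism m t))^[n] v ++ (applyMorphism (parryMorphism m t))^[n] w := by
  induction n generalizing v w with
  | zero => rfl
  | succ n ih =>
    simp only [Function.iterate_succ_apply]
    rw [← ih]
    simp [applyMorphism]

theorem iterate_replicate_zero (n k : ℕ) :
    (applyMorphism (parryMorphism m t))^[n] (List.replicate k 0) = wordPow (word m t n) k := by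
  induction k with
  | zero =>
    rw [wordPow_zero, List.replicate_zero]
    exact Function.iterate_fixed (by simp [applyMorphism]) n
  | succ k ih =>
    rw [List.replicate_succ, ← List.singleton_append, iterate_append, ih, wordPow_succ]
    rfl

theorem iterate_letter (n : ℕ) (k : Fin m) :
    (applyMorphism (parryMorphism m t))^[n] [k] =
      prodWord m t n (params t (k + 1) m) ++ if h : k + n < m then [⟨k + n, h⟩] else [] := by
  induction n generalizing k with
  | zero => simp [prodWord_zero]
  | succ n ih =>
    have hk := k.isLt
    rw [params_cons t (by omega), prodWord_succ_cons, Function.iterate_succ_apply]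
    have h1 : applyMorphism (parryMorphism m t) [k] = parryMorphism m t k := by
      simp [applyMorphism]
    rw [h1, parryMorphism, iterate_append, iterate_replicate_zero, List.append_assoc]
    congr 1
    split_ifs with h2 h3 h3
    · rw [ih]
      simp only [show (k : ℕ) + 1 + n = k + (n + 1) by ring, h3, dif_pos]
    · rw [ih]
      simp only [show (k : ℕ) + 1 + n = k + (n + 1) by ring, h3, dif_neg, not_false_eq_true]
    · omega
    · rw [params_eq_nil t (by omega), prodWord_nil]
      exact Function.iterate_fixed (by simp [applyMorphism]) n

/-- The recurrence `u_n = u_{n-1}^{t_1} u_{n-2}^{t_2} ⋯`, with the additional last letter `n` if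
`n < m`. -/
theorem word_eq (n : ℕ) :
    word m t n = prodWord m t n (params t 1 m) ++ if h : n < m then [⟨n, h⟩] else [] := by
  have := iterate_letter (t := t) n (0 : Fin m)
  simpa [word] using this

theorem prodWord_prefix_word (n : ℕ) : prodWord m t n (params t 1 m) <+: word m t n := by
  rw [word_eq n]
  exact List.prefix_append _ _

/-- Greedy comparison: if `a 0^ω` is smaller than `b 0^ω` and all nonempty proper suffixes of `a` are
smaller than `t_1 ⋯ t_m`, the product with exponents `a` is a prefix of the product with exponents `b`. -/
theorem prodWord_prefix {a b : List ℕ} (n : ℕ) (hab : LexLT a b)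
    (hs : ∀ v, v <:+ a.tail → v ≠ [] → LexLT v (params t 1 m)) :
    prodWord m t n a <+: prodWord m t n b := by
  induction a generalizing b n with
  | nil => simp [prodWord_nil]
  | cons x a ih =>
    cases b with
    | nil => exact absurd hab (not_lexLT_nil _)
    | cons y b =>
      cases n with
      | zero => simp [prodWord_zero]
      | succ n =>
        have hs' : ∀ v, v <:+ a.tail → v ≠ [] → LexLT v (params t 1 m) :=
          fun v hv => hs v (hv.trans (List.tail_suffix a))
        rw [prodWord_succ_cons, prodWord_succ_cons]
        rcases lexLT_cons_cons.1 hab with h | ⟨rfl, h⟩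
        · have h1 : prodWord m t n a <+: word m t n := by
            by_cases ha : a = []
            · simp [ha, prodWord_nil]
            · exact (ih n (hs a List.suffix_rfl ha) hs').trans (prodWord_prefix_word n)
          have h2 : wordPow (word m t n) x ++ prodWord m t n a <+:
              wordPow (word m t n) (x + 1) := by
            rw [wordPow_add, List.prefix_append_right_inj]
            simpa [wordPow] using h1
          exact (h2.trans (wordPow_prefix _ h)).trans (List.prefix_append _ _)
        · rw [List.prefix_append_right_inj]
          exact ih n h hs'

/-! ### Simple Parry sequences -/

theorem lenU_pos (n : ℕ) (h1 : 1 ≤ t 1) : 0 < lenU m t n := by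
  have hm := Nat.pos_of_ne_zero (NeZero.ne m)
  induction n with
  | zero => simp [lenU, word]
  | succ n ih =>
    have h2 := (prodWord_prefix_word (m := m) (t := t) (n + 1)).length_le
    rw [params_cons t hm, prodWord_succ_cons, List.length_append, length_wordPow] at h2
    change _ ≤ lenU m t (n + 1) at h2
    change t 1 * lenU m t n + _ ≤ _ at h2
    nlinarith

theorem wordPow_prefix_prodWord (n : ℕ) :
    wordPow (word m t n) (t 1) <+: prodWord m t (n + 1) (params t 1 m) := by
  rw [params_cons t (Nat.pos_of_ne_zero (NeZero.ne m)), prodWord_succ_cons]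
  exact List.prefix_append _ _

theorem word_prefix_of_le (h1 : 1 ≤ t 1) {n k : ℕ} (h : n ≤ k) : word m t n <+: word m t k := by
  induction k, h using Nat.le_induction with
  | base => exact List.prefix_rfl
  | succ k _ ih =>
    have h2 := (wordPow_prefix (word m t k) h1).trans
      ((wordPow_prefix_prodWord k).trans (prodWord_prefix_word (k + 1)))
    rw [wordPow_succ, wordPow_zero, List.append_nil] at h2
    exact ih.trans h2

theorem lenU_mono (h1 : 1 ≤ t 1) : Monotone (lenU m t) :=
  fun _ _ h => (word_prefix_of_le h1 h).length_le

namespace IsSimpleParry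

theorem apply_zero (hu : IsSimpleParry m t u) : u 0 = 0 := by
  have hm := hu.two_le
  have h1 := hu.fixed.1 1
  have h2 : applyMorphism (parryMorphism m t) (pref u 1) = parryMorphism m t (u 0) := by
    simp [applyMorphism, pref]
  rw [h2] at h1
  have hp : IsPref u (parryMorphism m t (u 0)) := by
    rw [h1]
    exact isPref_pref _ _
  by_contra hne
  by_cases hk : (u 0).val + 1 < m
  · rcases Nat.eq_zero_or_pos (t ((u 0).val + 1)) with h0 | h0
    · have h3 := hp 0 (by simp [parryMorphism, hk])
      simp only [parryMorphism, h0, hk, dif_pos, List.replicate_zero, List.nil_append,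
        List.getElem_cons_zero] at h3
      have := congrArg Fin.val h3
      simp at this
    · have h3 := hp 0 (by simp [parryMorphism, hk])
      simp only [parryMorphism] at h3
      rw [List.getElem_append_left (by simpa using h0), List.getElem_replicate] at h3
      exact hne h3.symm
  · have hlt := (u 0).isLt
    have h0 : 0 < t ((u 0).val + 1) := by
      rw [show (u 0).val + 1 = m by omega]
      exact hu.last_pos
    have h3 := hp 0 (by simp [parryMorphism, hk, h0])
    simp only [parryMorphism] at h3
    rw [List.getElem_append_left (by simpa using h0), List.getElem_replicate] at h3
    exact hne h3.symm

theorem isPref_word (hu : IsSimpleParry m t u) (n : ℕ) : IsPref u (word m t n) := by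
  induction n with
  | zero =>
    intro i hi
    obtain rfl : i = 0 := by simpa [word] using hi
    simp [word, hu.apply_zero]
  | succ n ih =>
    have h : word m t (n + 1) = applyMorphism (parryMorphism m t) (word m t n) :=
      Function.iterate_succ_apply' _ _ _
    rw [h, ih.eq_pref, hu.fixed.1]
    exact isPref_pref _ _

/-- The letter `k` ends the prefix `u_k`. -/
theorem apply_lenU_sub_one (hu : IsSimpleParry m t u) (k : Fin m) :
    u (lenU m t k - 1) = k := by
  have hpos := lenU_pos (m := m) k.val hu.first_pos
  have h := word_eq (m := m) (t := t) k
  rw [dif_pos k.isLt] at h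
  have hp := hu.isPref_word k (lenU m t k - 1) (by rw [lenU] at *; omega)
  rw [← hp]
  simp only [h, lenU, List.length_append, List.length_singleton, Nat.add_sub_cancel]
  simp

theorem lexLT_of_suffix (hu : IsSimpleParry m t u) {i : ℕ} (hi : 2 ≤ i) {v : List ℕ}
    (hv : v <:+ params t i m) (hne : v ≠ []) : LexLT v (params t 1 m) := by
  induction hd : m + 1 - i generalizing i with
  | zero =>
    rw [params_eq_nil t (by omega), List.suffix_nil] at hv
    exact absurd hv hne
  | succ d ih =>
    rw [params_cons t (by omega), List.suffix_cons_iff] at hv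
    rcases hv with rfl | hv
    · rw [← params_cons t (by omega)]
      exact hu.lex i hi (by omega)
    · exact ih (by omega) hv (by omega)

/-- `U_n` is a period of the prefix `u_n^{t_1} u_{n-1}^{t_2} ⋯` of `u`. -/
theorem period_prodWord (hu : IsSimpleParry m t u) (n i : ℕ)
    (hi : lenU m t n + i < (prodWord m t (n + 1) (params t 1 m)).length) :
    u (lenU m t n + i) = u i := by
  have hp : IsPref u (prodWord m t (n + 1) (params t 1 m)) :=
    (hu.isPref_word (n + 1)).of_prefix (prodWord_prefix_word _)
  refine hp.period (x := word m t n) (y := wordPow (word m t n) (t 1)) ?_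
    (hp.of_prefix (wordPow_prefix_prodWord n)) i hi
  rw [← wordPow_succ, params_cons t (by have := hu.two_le; omega), prodWord_succ_cons,
    wordPow_add, List.prefix_append_right_inj, wordPow_succ, wordPow_zero, List.append_nil]
  refine (prodWord_prefix n (hu.lex 2 le_rfl hu.two_le) ?_).trans (prodWord_prefix_word n)
  exact fun v hv => hu.lexLT_of_suffix le_rfl (hv.trans (List.tail_suffix _))

/-! ### The words `z_n` -/

theorem word_eq_append {n : ℕ} (hm : 1 ≤ m) (hn : m ≤ n) :
    word m t n =
      prodWord m t n (params t 1 (m - 1)) ++ wordPow (word m t (n - m)) (t m) := by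
  rw [word_eq n, dif_neg (by omega), List.append_nil, params_concat t hm hm, prodWord_append,
    length_params, show n - (m - 1 + 1 - 1) = n - m + 1 by omega, prodWord_succ_cons,
    prodWord_nil, List.append_nil]

theorem wordZ_eq {n : ℕ} (hn : m ≤ n) :
    wordZ m t n = word m t n ++ prodWord m t (n - m + 1) ((t 1 - t m) :: params t 2 m) := by
  rw [wordZ, prodWord_succ_cons, prodWord_params, List.append_assoc]
  congr 2
  · rw [wordInt, if_pos (by omega)]
    congr 2
    omega
  · congr 1
    funext j
    congr 2
    omega

/-- `z_n = (u_{n-1}^{t_1} ⋯ u_{n-m+1}^{t_{m-1}}) (u_{n-m}^{t_1} u_{n-m-1}^{t_2} ⋯)`. -/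
theorem wordZ_eq_append {n : ℕ} (hm : 1 ≤ m) (hn : m ≤ n) (ht : t m ≤ t 1) :
    wordZ m t n =
      prodWord m t n (params t 1 (m - 1)) ++ prodWord m t (n - m + 1) (params t 1 m) := by
  have h : wordPow (word m t (n - m)) (t 1) =
      wordPow (word m t (n - m)) (t m) ++ wordPow (word m t (n - m)) (t 1 - t m) := by
    rw [← wordPow_add, Nat.add_sub_cancel' ht]
  rw [wordZ_eq hn, word_eq_append hm hn, params_cons t hm, prodWord_succ_cons,
    prodWord_succ_cons, h]
  simp only [List.append_assoc]

theorem wordZ_prefix_word (hu : IsSimpleParry m t u) (h2 : 2 ≤ t 1) {n : ℕ} (hn : m ≤ n) :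
    wordZ m t n <+: word m t (n + 1) := by
  have hm := hu.two_le
  refine List.IsPrefix.trans ?_
    ((wordPow_prefix (word m t n) h2).trans
      ((wordPow_prefix_prodWord n).trans (prodWord_prefix_word _)))
  rw [wordZ_eq hn, wordPow_succ, wordPow_succ, wordPow_zero, List.append_nil,
    List.prefix_append_right_inj]
  have h3 : LexLT ((t 1 - t m) :: params t 2 m) (params t 1 m) := by
    have h1 := hu.last_pos
    have h0 := hu.first_pos
    rw [params_cons t (i := 1) (by omega), lexLT_cons_cons]
    exact Or.inl (by omega)
  exact ((prodWord_prefix _ h3 fun v hv => hu.lexLT_of_suffix le_rfl hv).trans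
    (prodWord_prefix_word _)).trans (word_prefix_of_le hu.first_pos (by omega))

theorem isPref_wordZ (hu : IsSimpleParry m t u) (h2 : 2 ≤ t 1) {n : ℕ} (hn : m ≤ n) :
    IsPref u (wordZ m t n) :=
  (hu.isPref_word (n + 1)).of_prefix (hu.wordZ_prefix_word h2 hn)

/-- With the last exponent raised, the nonempty proper suffixes of `t_1 ⋯ t_{m-2} (t_{m-1} + 1)` are
still smaller than `t_1 ⋯ t_m`. -/
theorem lexLT_of_suffix_raised (hu : IsSimpleParry m t u)
    (hlex : ∀ i, 2 ≤ i → i ≤ m - 2 →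
      LexLT (params t i (m - 2) ++ [t (m - 1) + 1]) (params t 1 m))
    (hmax : t (m - 1) < t 1) {i : ℕ} (hi : 2 ≤ i) {v : List ℕ}
    (hv : v <:+ params t i (m - 2) ++ [t (m - 1) + 1]) (hne : v ≠ []) :
    LexLT v (params t 1 m) := by
  have hm := hu.two_le
  induction hd : m - 1 - i generalizing i with
  | zero =>
    rw [params_eq_nil t (by omega), List.nil_append, List.suffix_cons_iff, List.suffix_nil] at hv
    obtain rfl : v = [t (m - 1) + 1] := hv.resolve_right hne
    rw [params_cons t (by omega), lexLT_cons_cons]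
    rcases Nat.lt_or_eq_of_le (Nat.succ_le_of_lt hmax) with h | h
    · exact Or.inl h
    · -- The two first terms agree; the comparison is decided by `t_m ≥ 1`.
      refine Or.inr ⟨h, nil_lexLT ⟨t m, ?_, hu.last_pos⟩⟩
      exact List.mem_map.2 ⟨m, List.Ico.mem.2 ⟨by omega, by omega⟩, rfl⟩
  | succ d ih =>
    rw [params_cons t (by omega), List.cons_append, List.suffix_cons_iff] at hv
    rcases hv with rfl | hv
    · rw [← List.cons_append, ← params_cons t (by omega)]
      exact hlex i hi (by omega)
    · exact ih (by omega) hv (by omega)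

/-- `U_{n-1}` is a period of the prefix `z_n` of `u`. -/
theorem period_wordZ (hu : IsSimpleParry m t u)
    (hlex : ∀ i, 2 ≤ i → i ≤ m - 2 →
      LexLT (params t i (m - 2) ++ [t (m - 1) + 1]) (params t 1 m))
    (hmax : max (t (m - 1)) (t m) < t 1) {n : ℕ} (hn : m ≤ n) (i : ℕ)
    (hi : lenU m t (n - 1) + i < lenZ m t n) : u (lenU m t (n - 1) + i) = u i := by
  have hm := hu.two_le
  obtain ⟨hmax1, hmax2⟩ := max_lt_iff.1 hmax
  have h1 := hu.last_pos
  have hm3 : 3 ≤ m := by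
    -- For `m = 2` the hypothesis would read `t 1 < t 1`.
    rcases Nat.lt_or_ge 2 m with h | h
    · exact h
    · obtain rfl : m = 2 := by omega
      exact absurd hmax1 (lt_irrefl _)
  have hpow : IsPref u (wordPow (word m t (n - 1)) (t 1)) :=
    (hu.isPref_word (n - 1 + 1)).of_prefix
      ((wordPow_prefix_prodWord _).trans (prodWord_prefix_word _))
  refine (hu.isPref_wordZ (by omega) hn).period (x := word m t (n - 1)) ?_ hpow i hi
  have hz : wordZ m t n <+: prodWord m t n (params t 1 (m - 2) ++ [t (m - 1) + 1]) := by
    rw [wordZ_eq_append (by omega) hn hmax2.le, params_concat t (j := m - 1) (by omega) (by omega),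
      prodWord_append, prodWord_append, length_params, length_params, List.append_assoc,
      show m - 1 - 1 = m - 2 by omega, List.prefix_append_right_inj,
      show n - (m - 2 + 1 - 1) = n - m + 1 + 1 by omega, prodWord_succ_cons, prodWord_succ_cons,
      prodWord_nil, List.append_nil, List.append_nil, wordPow_add,
      List.prefix_append_right_inj, wordPow_succ, wordPow_zero, List.append_nil]
    exact prodWord_prefix_word _
  refine hz.trans ?_
  obtain ⟨k, rfl⟩ : ∃ k, n = k + 1 := ⟨n - 1, by omega⟩
  rw [params_cons t (by omega), List.cons_append, prodWord_succ_cons, Nat.add_sub_cancel,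
    ← wordPow_succ, wordPow_add, List.prefix_append_right_inj, wordPow_succ, wordPow_zero,
    List.append_nil]
  refine (prodWord_prefix k ?_ ?_).trans (prodWord_prefix_word k)
  · exact hu.lexLT_of_suffix_raised hlex hmax1 le_rfl List.suffix_rfl (by simp)
  · exact fun v hv => hu.lexLT_of_suffix_raised hlex hmax1 le_rfl
      (hv.trans (List.tail_suffix _))

/-- The word `u_{n-m}^{t_1} u_{n-m-1}^{t_2} ⋯` has an occurrence in `u` that starts `t_m U_{n-m}`
letters before the end of `u_n` and ends where `z_n` ends. -/
theorem exists_copy (hu : IsSimpleParry m t u) (h2 : 2 ≤ t 1) (ht : t m ≤ t 1)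
    {n : ℕ} (hn : m ≤ n) :
    ∃ B, B + t m * lenU m t (n - m) = lenU m t n ∧
      B + (prodWord m t (n - m + 1) (params t 1 m)).length = lenZ m t n ∧
      ∀ i < (prodWord m t (n - m + 1) (params t 1 m)).length, u (B + i) = u i := by
  have hm := hu.two_le
  have hz := wordZ_eq_append (t := t) (by omega) hn ht
  have hlz : _ = lenZ m t n := (congrArg List.length hz).symm
  rw [List.length_append] at hlz
  refine ⟨(prodWord m t n (params t 1 (m - 1))).length, ?_, hlz, fun i hi => ?_⟩
  · rw [lenU, lenU, word_eq_append (n := n) (by omega) hn, List.length_append, length_wordPow]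
  · exact (hu.isPref_wordZ h2 hn).period ⟨[], by rw [List.append_nil, hz]⟩
      ((hu.isPref_word _).of_prefix (prodWord_prefix_word _)) i
      (by change _ < lenZ m t n; omega)

/-! ### The attractors `Γ_n` -/

/-- Both cases of the definition of `Γ_n` in one: for `n ≤ m - 1` the bound `n < i + m` holds for
every `i`. -/
theorem mem_gam (hm : 1 ≤ m) {n g : ℕ} :
    g ∈ Gam m t n ↔ ∃ i, n < i + m ∧ i ≤ n ∧ lenU m t i - 1 = g := by
  unfold Gam
  split_ifs with h
  · simp only [Finset.mem_image, Finset.mem_Icc]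
    exact ⟨fun ⟨i, hi, e⟩ => ⟨i, by omega, hi.2, e⟩, fun ⟨i, _, hi, e⟩ => ⟨i, ⟨by omega, hi⟩, e⟩⟩
  · simp only [Finset.mem_image, Finset.mem_Icc]
    exact ⟨fun ⟨i, hi, e⟩ => ⟨i, by omega, hi.2, e⟩,
      fun ⟨i, h1, hi, e⟩ => ⟨i, ⟨by omega, hi⟩, e⟩⟩

theorem card_gam_le (hm : 1 ≤ m) (n : ℕ) : (Gam m t n).card ≤ min (n + 1) m := by
  unfold Gam
  split_ifs with h <;>
  · refine Finset.card_image_le.trans ?_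
    rw [Nat.card_Icc]
    omega

/-- Minimality of `Γ_n` comes from counting letters: the prefix `u_n` contains `min (n + 1) m`
of them. -/
theorem isMinimalAttractor_gam (hu : IsSimpleParry m t u) {n ℓ : ℕ} (hl : lenU m t n ≤ ℓ)
    (h : Covers u (Gam m t n) ℓ ℓ) : IsMinimalAttractor (pref u ℓ) (Gam m t n) := by
  have hm := hu.two_le
  have hlt : ∀ i ≤ n, lenU m t i - 1 < ℓ := by
    intro i hi
    have h1 := lenU_mono (m := m) hu.first_pos hi
    have h2 := lenU_pos (m := m) i hu.first_pos
    omega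
  refine ⟨h.isAttractor ?_, fun Δ hΔ => (card_gam_le (by omega) n).trans ?_⟩
  · intro g hg
    obtain ⟨i, -, hi, rfl⟩ := (mem_gam (by omega)).1 hg
    exact hlt i hi
  · have hcard : (Finset.univ.filter fun k : Fin m => k.val < n + 1).card = min (n + 1) m := by
      rw [Fin.card_filter_val_lt, min_comm]
    rw [← hcard]
    refine hΔ.card_le fun k hk => ⟨lenU m t k - 1, hlt k ?_, hu.apply_lenU_sub_one k⟩
    have := (Finset.mem_filter.1 hk).2
    omega

theorem lenU_sub_one_mem_gam (hm : 1 ≤ m) (n : ℕ) : lenU m t n - 1 ∈ Gam m t n :=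
  (mem_gam hm).2 ⟨n, by omega, le_rfl, rfl⟩

theorem lenU_eq (n : ℕ) :
    lenU m t n = (prodWord m t n (params t 1 m)).length + if n < m then 1 else 0 := by
  rw [lenU, word_eq n, List.length_append]
  split_ifs <;> rfl

/-- The attractors of the short prefixes, which contain all the positions `U_i - 1`. -/
theorem covers_gam_of_le (hu : IsSimpleParry m t u) {n ℓ : ℕ} (hn : n ≤ m - 1)
    (h1 : lenU m t n ≤ ℓ) (h2 : ℓ ≤ (prodWord m t (n + 1) (params t 1 m)).length) :
    Covers u (Gam m t n) ℓ ℓ := by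
  have hm := hu.two_le
  -- It suffices to treat `ℓ = U_n`; longer prefixes follow by periodicity.
  suffices h : ∀ k ≤ m - 1, Covers u (Gam m t k) (lenU m t k) (lenU m t k) by
    exact ((h n hn).mono le_rfl h1).of_period (lenU_pos n hu.first_pos)
      (lenU_sub_one_mem_gam (by omega) n) fun i hi => hu.period_prodWord n i (by omega)
  intro k hk
  induction k with
  | zero =>
    have h0 : lenU m t 0 = 1 := rfl
    intro s len hl hs
    rw [h0] at hs ⊢
    exact ⟨s, hs, fun _ _ => rfl, 0, lenU_sub_one_mem_gam (by omega) 0,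
      by omega, by omega⟩
  | succ k ih =>
    have hV := lenU_eq (m := m) (t := t) (k + 1)
    rw [if_pos (by omega)] at hV
    have hle : lenU m t k ≤ (prodWord m t (k + 1) (params t 1 m)).length := by
      have := (wordPow_prefix (word m t k) hu.first_pos).trans (wordPow_prefix_prodWord k)
      simpa [length_wordPow, lenU] using this.length_le
    have hc := ((ih (by omega)).mono le_rfl hle).of_period (lenU_pos k hu.first_pos)
      (lenU_sub_one_mem_gam (by omega) k) fun i hi => hu.period_prodWord k i hi
    have hsub : Gam m t k ⊆ Gam m t (k + 1) := by
      intro g hg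
      obtain ⟨i, -, hi, e⟩ := (mem_gam (by omega)).1 hg
      exact (mem_gam (by omega)).2 ⟨i, by omega, by omega, e⟩
    rw [hV]
    refine (hc.mono_set hsub).succ ?_
    have := lenU_sub_one_mem_gam (m := m) (t := t) (by omega) (k + 1)
    rwa [hV, Nat.add_sub_cancel] at this

/-- Passing from `Γ_{n-1}` to `Γ_n`: a factor of `u_n` met only by the lost position
`U_{n-m} - 1` lies in `u_{n-m}^{t_1} u_{n-m-1}^{t_2} ⋯`. A copy of this word straddles the new
position `U_n - 1` inside `z_n`, and as `t_m < t_1`, the factor can be moved across `U_n - 1` by a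
multiple of its period `U_{n-m}`. -/
theorem covers_gam_step (hu : IsSimpleParry m t u) (ht : t m < t 1) {n : ℕ} (hn : m ≤ n)
    (h : Covers u (Gam m t (n - 1)) (lenU m t n) (lenU m t n)) :
    Covers u (Gam m t n) (lenU m t n) (lenZ m t n) := by
  have hm := hu.two_le
  have hc := hu.last_pos
  obtain ⟨B, hB1, hB2, hB3⟩ := hu.exists_copy (by omega) ht.le hn
  have hper := hu.period_prodWord (n - m)
  have hV : lenU m t (n - m + 1) ≤ (prodWord m t (n - m + 1) (params t 1 m)).length + 1 := by
    rw [lenU_eq]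
    split_ifs <;> omega
  have ht1 : t 1 * lenU m t (n - m) ≤ (prodWord m t (n - m + 1) (params t 1 m)).length := by
    have := (wordPow_prefix_prodWord (m := m) (t := t) (n - m)).length_le
    rwa [length_wordPow] at this
  have hp := lenU_pos (m := m) (n - m) hu.first_pos
  have hmem := lenU_sub_one_mem_gam (m := m) (t := t) (by omega) n
  generalize (prodWord m t (n - m + 1) (params t 1 m)).length = V at *
  have hct : (t m + 1) * lenU m t (n - m) ≤ t 1 * lenU m t (n - m) := Nat.mul_le_mul_right _ ht
  intro s len hl hs
  obtain ⟨s', h1, h2, g, hg, h3, h4⟩ := h s len hl hs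
  by_cases hg' : ∃ g ∈ Gam m t n, s' ≤ g ∧ g < s' + len
  · refine ⟨s', h1.trans ?_, h2, hg'⟩
    nlinarith
  obtain ⟨i, hi1, hi2, rfl⟩ := (mem_gam (by omega)).1 hg
  -- Every position of `Γ_{n-1}` except `U_{n-m} - 1` also belongs to `Γ_n`.
  obtain rfl : i = n - m := by
    by_contra hne
    exact hg' ⟨_, (mem_gam (by omega)).2 ⟨i, by omega, by omega, rfl⟩, h3, h4⟩
  -- `U_{n-m+1} - 1` is in `Γ_n`, so the factor ends before it; this excludes the extra last letter
  -- of `u_{n-m+1}` if there is one.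
  have hend : s' + len ≤ V := by
    by_contra hlt
    have hmono := lenU_mono (m := m) hu.first_pos (show n - m ≤ n - m + 1 by omega)
    exact hg' ⟨_, (mem_gam (by omega)).2 ⟨n - m + 1, by omega, by omega, rfl⟩, by omega, by omega⟩
  set p := lenU m t (n - m) with hpdef
  obtain ⟨c, hc'⟩ : ∃ c, t m = c + 1 := ⟨t m - 1, by omega⟩
  rw [hc'] at hB1 hct
  have e1 : (c + 1) * p = p * c + p := by ring
  have e2 : (c + 1 + 1) * p = p * c + p + p := by ring
  rw [e1] at hB1
  rw [e2] at hct
  -- The least shift that moves the end of the factor beyond the position `U_n - 1`.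
  have hex : ∃ j, p * c + p ≤ s' + len + p * j := ⟨c, by omega⟩
  obtain ⟨j, hj1, hj2⟩ : ∃ j, p * c + p ≤ s' + len + p * j ∧
      (j = 0 ∨ s' + len + p * j < p * c + p + p) := by
    refine ⟨Nat.find hex, Nat.find_spec hex, ?_⟩
    rcases Nat.eq_zero_or_pos (Nat.find hex) with h0 | h0
    · exact Or.inl h0
    · right
      have := Nat.find_min hex (Nat.sub_lt h0 Nat.one_pos)
      obtain ⟨d, hd⟩ := Nat.exists_eq_succ_of_ne_zero h0.ne'
      rw [hd, Nat.succ_sub_one] at this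
      rw [hd, Nat.mul_succ]
      omega
  have hstart : s' + p * j ≤ p * c + p - 1 := by
    rcases hj2 with rfl | hj2
    · simp only [Nat.mul_zero]
      omega
    · have hjc : p * j < p * (c + 1) := by rw [Nat.mul_succ]; omega
      have hjc' := Nat.mul_le_mul_left p (Nat.le_of_lt_succ (Nat.lt_of_mul_lt_mul_left hjc))
      omega
  have hfin : s' + len + p * j ≤ V := by
    rcases hj2 with rfl | hj2
    · simpa using hend
    · omega
  refine ⟨B + (p * j + s'), by omega, fun k hk => ?_, _, hmem, by omega, by omega⟩
  rw [← h2 k hk, add_assoc, hB3 _ (by omega), add_assoc]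
  exact apply_mul_add_of_period hper j _ (by omega)

theorem lenU_le_lenZ {n : ℕ} (hn : m ≤ n) : lenU m t n ≤ lenZ m t n := by
  rw [lenZ, wordZ_eq hn, List.length_append]
  exact Nat.le_add_right _ _

theorem lenU_succ_eq {n : ℕ} (hn : m ≤ n + 1) :
    lenU m t (n + 1) = (prodWord m t (n + 1) (params t 1 m)).length := by
  rw [lenU_eq, if_neg (by omega), add_zero]

theorem covers_gam_of_lenZ_le (hu : IsSimpleParry m t u) (ht : t m < t 1) {n ℓ : ℕ} (hn : m ≤ n)
    (h : Covers u (Gam m t (n - 1)) (lenU m t n) (lenU m t n))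
    (h1 : lenZ m t n ≤ ℓ) (h2 : ℓ ≤ lenU m t (n + 1)) : Covers u (Gam m t n) ℓ ℓ := by
  have hm := hu.two_le
  rw [lenU_succ_eq (by omega)] at h2
  exact ((hu.covers_gam_step ht hn h).mono le_rfl h1).of_period (lenU_pos n hu.first_pos)
    (lenU_sub_one_mem_gam (by omega) n) fun i hi => hu.period_prodWord n i (by omega)

/-- In the range `[U_n, Z_n]`, the previous attractor survives, as `U_{n-1}` is still a period. -/
theorem covers_gam_of_le_lenZ (hu : IsSimpleParry m t u)
    (hlex : ∀ i, 2 ≤ i → i ≤ m - 2 →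
      LexLT (params t i (m - 2) ++ [t (m - 1) + 1]) (params t 1 m))
    (hmax : max (t (m - 1)) (t m) < t 1) {n ℓ : ℕ} (hn : m ≤ n)
    (h : Covers u (Gam m t (n - 1)) (lenU m t n) (lenU m t n))
    (h1 : lenU m t n ≤ ℓ) (h2 : ℓ ≤ lenZ m t n) : Covers u (Gam m t (n - 1)) ℓ ℓ := by
  have hm := hu.two_le
  exact (h.mono (lenU_mono hu.first_pos (Nat.sub_le n 1)) h1).of_period
    (lenU_pos _ hu.first_pos) (lenU_sub_one_mem_gam (by omega) _)
    fun i hi => hu.period_wordZ hlex hmax hn i (by omega)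

theorem covers_gam_lenU (hu : IsSimpleParry m t u) (ht : t m < t 1) {n : ℕ} (hn : m ≤ n) :
    Covers u (Gam m t (n - 1)) (lenU m t n) (lenU m t n) := by
  have hm := hu.two_le
  have hc := hu.last_pos
  induction n, hn using Nat.le_induction with
  | base =>
    have e := lenU_succ_eq (m := m) (t := t) (n := m - 1) (by omega)
    have hle := lenU_mono (m := m) hu.first_pos (Nat.sub_le m 1)
    rw [Nat.sub_add_cancel (by omega)] at e
    refine hu.covers_gam_of_le le_rfl hle ?_
    rw [Nat.sub_add_cancel (by omega), ← e]
  | succ n hn ih =>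
    exact hu.covers_gam_of_lenZ_le ht hn ih (hu.wordZ_prefix_word (by omega) hn).length_le le_rfl

/-- Every positive length lies in some interval `[U_n, U_{n+1})`. -/
theorem exists_lenU_le_lt (hu : IsSimpleParry m t u) (h2 : 2 ≤ t 1) {ℓ : ℕ} (hl : 0 < ℓ) :
    ∃ n, lenU m t n ≤ ℓ ∧ ℓ < lenU m t (n + 1) := by
  have hgrow : ∀ n, n < lenU m t n := by
    intro n
    induction n with
    | zero => exact lenU_pos 0 hu.first_pos
    | succ n ih =>
      have := ((wordPow_prefix (word m t n) h2).trans
        ((wordPow_prefix_prodWord n).trans (prodWord_prefix_word _))).length_le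
      rw [length_wordPow] at this
      change 2 * lenU m t n ≤ lenU m t (n + 1) at this
      omega
  have hex : ∃ n, ℓ < lenU m t n := ⟨ℓ, hgrow ℓ⟩
  have hspec := Nat.find_spec hex
  rcases Nat.eq_zero_or_pos (Nat.find hex) with h0 | h0
  · rw [h0] at hspec
    have : lenU m t 0 = 1 := rfl
    omega
  · have hmin := Nat.find_min hex (Nat.sub_lt h0 Nat.one_pos)
    refine ⟨Nat.find hex - 1, not_lt.1 hmin, ?_⟩
    rwa [Nat.sub_add_cancel h0]

theorem gam_subset (hm : 1 ≤ m) (n : ℕ) :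
    (Gam m t n : Set ℕ) ⊆ {p | ∃ n : ℕ, p = lenU m t n - 1} := by
  intro g hg
  obtain ⟨i, -, -, rfl⟩ := (mem_gam hm).1 hg
  exact ⟨i, rfl⟩

end IsSimpleParry

end SimpleParry

theorem mainTheorem2 (m : ℕ) [NeZero m] (t : ℕ → ℕ) (u : ℕ → Fin m)
    (hu : SimpleParry.IsSimpleParry m t u)
    (hlex : ∀ i, 2 ≤ i → i ≤ m - 2 →
      SimpleParry.LexLT (SimpleParry.params t i (m - 2) ++ [t (m - 1) + 1])
        (SimpleParry.params t 1 m))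
    (hmax : max (t (m - 1)) (t m) < t 1) :
    (∀ ℓ : ℕ, ∃ Γ : Finset ℕ,
      (Γ : Set ℕ) ⊆ {p | ∃ n : ℕ, p = SimpleParry.lenU m t n - 1} ∧
      SimpleParry.IsMinimalAttractor (SimpleParry.pref u ℓ) Γ) ∧
    (∀ n ℓ : ℕ, n ≤ m - 1 →
      ℓ ∈ Set.Icc (SimpleParry.lenU m t n) (SimpleParry.lenU m t (n + 1) - 1) →
      SimpleParry.IsMinimalAttractor (SimpleParry.pref u ℓ) (SimpleParry.Gam m t n)) ∧
    (∀ n ℓ : ℕ, m ≤ n →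
      ℓ ∈ Set.Icc (SimpleParry.lenU m t n) (SimpleParry.lenZ m t n) →
      SimpleParry.IsMinimalAttractor (SimpleParry.pref u ℓ) (SimpleParry.Gam m t (n - 1))) ∧
    (∀ n ℓ : ℕ, m ≤ n →
      ℓ ∈ Set.Icc (SimpleParry.lenZ m t n) (SimpleParry.lenU m t (n + 1)) →
      SimpleParry.IsMinimalAttractor (SimpleParry.pref u ℓ) (SimpleParry.Gam m t n)) := by
  have hm := hu.two_le
  have hc := hu.last_pos
  have ht := (max_lt_iff.1 hmax).2
  have short : ∀ n ℓ : ℕ, n ≤ m - 1 →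
      ℓ ∈ Set.Icc (SimpleParry.lenU m t n) (SimpleParry.lenU m t (n + 1) - 1) →
      SimpleParry.IsMinimalAttractor (SimpleParry.pref u ℓ) (SimpleParry.Gam m t n) := by
    rintro n ℓ hn ⟨h1, h2⟩
    refine hu.isMinimalAttractor_gam h1 (hu.covers_gam_of_le hn h1 (h2.trans ?_))
    rw [SimpleParry.IsSimpleParry.lenU_eq]
    split_ifs <;> omega
  have low : ∀ n ℓ : ℕ, m ≤ n →
      ℓ ∈ Set.Icc (SimpleParry.lenU m t n) (SimpleParry.lenZ m t n) →
      SimpleParry.IsMinimalAttractor (SimpleParry.pref u ℓ) (SimpleParry.Gam m t (n - 1)) := by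
    rintro n ℓ hn ⟨h1, h2⟩
    exact hu.isMinimalAttractor_gam
      ((SimpleParry.lenU_mono hu.first_pos (Nat.sub_le n 1)).trans h1)
      (hu.covers_gam_of_le_lenZ hlex hmax hn (hu.covers_gam_lenU ht hn) h1 h2)
  have high : ∀ n ℓ : ℕ, m ≤ n →
      ℓ ∈ Set.Icc (SimpleParry.lenZ m t n) (SimpleParry.lenU m t (n + 1)) →
      SimpleParry.IsMinimalAttractor (SimpleParry.pref u ℓ) (SimpleParry.Gam m t n) := by
    rintro n ℓ hn ⟨h1, h2⟩
    exact hu.isMinimalAttractor_gam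
      ((SimpleParry.IsSimpleParry.lenU_le_lenZ hn).trans h1)
      (hu.covers_gam_of_lenZ_le ht hn (hu.covers_gam_lenU ht hn) h1 h2)
  refine ⟨fun ℓ => ?_, short, low, high⟩
  rcases Nat.eq_zero_or_pos ℓ with rfl | hl
  · refine ⟨∅, by simp, ⟨by simp, ?_⟩, by simp⟩
    rintro f hf hfw
    exact absurd (List.infix_nil.1 hfw) hf
  · obtain ⟨n, h1, h2⟩ := hu.exists_lenU_le_lt (by omega) hl
    rcases Nat.lt_or_ge n m with hn | hn
    · exact ⟨_, SimpleParry.IsSimpleParry.gam_subset (by omega) n,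
        short n ℓ (by omega) ⟨h1, by omega⟩⟩
    · rcases le_total ℓ (SimpleParry.lenZ m t n) with h3 | h3
      · exact ⟨_, SimpleParry.IsSimpleParry.gam_subset (by omega) _, low n ℓ hn ⟨h1, h3⟩⟩
      · exact ⟨_, SimpleParry.IsSimpleParry.gam_subset (by omega) _, high n ℓ hn ⟨h3, h2.le⟩⟩
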